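/- Let $N\ge 1$ and $d\ge 2$ be integers. For $A\in\operatorname{SL}_N(\overline{\mathbb{Q}})$ and $\mathbf{b}\in\overline{\mathbb{Q}}^N$ let $f_{A,\mathbf{b}}:\mathbb{P}^N\to\mathbb{P}^N$ be the extension to $\mathbb{P}^N$ of the map $\mathbf{X}\mapsto A\mathbf{X}^d+\mathbf{b}$ of $\mathbb{A}^N$, where $\mathbf{X}^d=(X_1^d,\dots,X_N^d)$; that is, $f_{A,\mathbf{b}}([\mathbf{X}:Z])=[A\mathbf{X}^d+Z^d\mathbf{b}:Z^d]$. An endomorphism $f$ of $\mathbb{P}^N$ over $\overline{\mathbb{Q}}$ is called post-critically finite (PCF) if its post-critical locus $P_f=\bigcup_{n\ge 1}f^n(C_f)$ is a (proper) algebraic subset of $\mathbb{P}^N$, where $C_f$ is the critical locus, defined by the vanishing of the determinant of the Jacobian matrix of $f$. For a tuple $x$ of elements, not all zero, of a number field $F$ write \[h(x)=\sum_v\frac{[F_v:\mathbb{Q}_v]}{[F:\mathbb{Q}]}\log\max_i|x_i|_v\] (sum over all places $v$ of $F$) for the absolute logarithmic height of $x$, which does not depend on $F$; let $h(A)$ be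 the height of the tuple of entries of $A$, and let $h(\mathbf{b})$ be the height of $(b_1,\dots,b_N,1)$. For every $B\ge 0$ there is a constant $C$, depending only on $d$, $N$ and $B$, such that for all $A\in\operatorname{SL}_N(\overline{\mathbb{Q}})$ with $h(A)\le B$ and all $\mathbf{b}\in\overline{\mathbb{Q}}^N$: if $f_{A,\mathbf{b}}$ is PCF, then $h(\mathbf{b})\le C$. -/

import Mathlib

open scoped LinearAlgebra.Projectivization

noncomputable section

/-- The absolute logarithmic height of the tuple `x` of algebraic numbers, as homogeneous
coordinates: for `F = ℚ(x)` it is `∑_v ([F_v : ℚ_v] / [F : ℚ]) log max_i |x i|_v`,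
the sum being over all places `v` of `F` (the zero tuple gets height `0`). -/
def absLogHeight {ι : Type*} [Finite ι] (x : ι → AlgebraicClosure ℚ) : ℝ :=
  haveI : FiniteDimensional ℚ (IntermediateField.adjoin ℚ (Set.range x)) :=
    IntermediateField.finiteDimensional_adjoin fun y _ =>
      ((AlgebraicClosure.isAlgebraic ℚ).isAlgebraic y).isIntegral
  haveI : NumberField (IntermediateField.adjoin ℚ (Set.range x)) := {}
  Height.logHeight (K := IntermediateField.adjoin ℚ (Set.range x))
      (fun i => ⟨x i, IntermediateField.subset_adjoin ℚ _ (Set.mem_range_self i)⟩) /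
    (Module.finrank ℚ (IntermediateField.adjoin ℚ (Set.range x)) : ℝ)

/-- The height of a matrix: the height of its tuple of entries, as a point of projective space. -/
def matrixHeight {N : ℕ} (A : Matrix (Fin N) (Fin N) (AlgebraicClosure ℚ)) : ℝ :=
  absLogHeight fun p : Fin N × Fin N => A p.1 p.2

/-- The height of `b ∈ 𝔸^N`, i.e. of the point `[b₁ : ⋯ : b_N : 1] ∈ ℙ^N`. -/
def affineHeight {N : ℕ} (b : Fin N → AlgebraicClosure ℚ) : ℝ :=
  absLogHeight (Fin.snoc b 1 : Fin (N + 1) → AlgebraicClosure ℚ)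

/-- A degree-`d` endomorphism of the projective space with coordinates indexed by `σ` over an
algebraically closed field `K`, presented by forms of degree `d` with no common zero. -/
structure ProjEndo (K : Type*) [Field K] (σ : Type*) (d : ℕ) where
  form : σ → MvPolynomial σ K
  isHomogeneous : ∀ i, (form i).IsHomogeneous d
  eq_zero_of_eval : ∀ v : σ → K, (∀ i, MvPolynomial.eval v (form i) = 0) → v = 0

namespace ProjEndo

variable {K : Type*} [Field K] {σ : Type*} {d : ℕ}

/-- The action on homogeneous coordinate vectors. -/
def evalVec (f : ProjEndo K σ d) (v : σ → K) : σ → K :=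
  fun i => MvPolynomial.eval v (f.form i)

theorem evalVec_ne_zero (f : ProjEndo K σ d) {v : σ → K} (hv : v ≠ 0) : f.evalVec v ≠ 0 :=
  fun h => hv (f.eq_zero_of_eval v fun i => congrFun h i)

theorem evalVec_smul (f : ProjEndo K σ d) (t : K) (v : σ → K) :
    f.evalVec (t • v) = t ^ d • f.evalVec v := by
  funext i
  simp only [evalVec, Pi.smul_apply, smul_eq_mul]
  rw [MvPolynomial.eval_eq, MvPolynomial.eval_eq, Finset.mul_sum]
  refine Finset.sum_congr rfl fun m hm => ?_
  have hd : ∑ j ∈ m.support, m j = d := by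
    have := (f.isHomogeneous i) (MvPolynomial.mem_support_iff.mp hm)
    rwa [Finsupp.weight_apply, Finsupp.sum, Finset.sum_congr rfl (g := fun j => m j)
      (fun j _ => by simp)] at this
  simp only [Pi.smul_apply, smul_eq_mul, mul_pow, Finset.prod_mul_distrib,
    Finset.prod_pow_eq_pow_sum, hd]
  ring

/-- The self-map of (the closed points of) projective space. -/
def toFun (f : ProjEndo K σ d) : ℙ K (σ → K) → ℙ K (σ → K) :=
  Projectivization.lift
    (fun v => Projectivization.mk K (f.evalVec v.1) (f.evalVec_ne_zero v.2)) (by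
      intro v w t h
      refine (Projectivization.mk_eq_mk_iff' K _ _ _ _).2 ⟨t ^ d, ?_⟩
      rw [← f.evalVec_smul, ← h])

/-- The critical locus: the vanishing of the determinant of the Jacobian matrix. -/
def critLocus [Fintype σ] [DecidableEq σ] (f : ProjEndo K σ d) : Set (ℙ K (σ → K)) :=
  {P | MvPolynomial.eval P.rep
    (Matrix.det (Matrix.of fun i j => MvPolynomial.pderiv j (f.form i))) = 0}

/-- The post-critical locus `⋃_{n ≥ 1} fⁿ(C_f)`. -/
def postCritLocus [Fintype σ] [DecidableEq σ] (f : ProjEndo K σ d) : Set (ℙ K (σ → K)) :=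
  ⋃ n : ℕ, f.toFun^[n + 1] '' f.critLocus

end ProjEndo

/-- Zariski closed subsets of projective space: common zero loci of sets of forms. -/
def IsProjAlgebraic {K : Type*} [Field K] {σ : Type*} (S : Set (ℙ K (σ → K))) : Prop :=
  ∃ I : Set (MvPolynomial σ K), (∀ p ∈ I, ∃ n, p.IsHomogeneous n) ∧
    S = {P | ∀ p ∈ I, MvPolynomial.eval P.rep p = 0}

/-- `f` is post-critically finite: its post-critical locus is a (proper) algebraic subset.
Being a countable union of hypersurfaces, the locus is algebraic as a union of subvarieties iff
that union is finite, and the union is then a proper subset. Over a countable field, infinitely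
many hypersurfaces could conceivably exhaust the closed points, hence the second clause. -/
def ProjEndo.IsPCF {K : Type*} [Field K] {σ : Type*} [Fintype σ] [DecidableEq σ] {d : ℕ}
    (f : ProjEndo K σ d) : Prop :=
  IsProjAlgebraic f.postCritLocus ∧ f.postCritLocus ≠ Set.univ

/-- The extension to `ℙ^N` of the map `X ↦ A X^d + b` of `𝔸^N`, i.e.
`[X : Z] ↦ [A X^d + b Z^d : Z^d]`, with `Z` the last coordinate. -/
def powerAffineEndo {K : Type*} [Field K] {N d : ℕ} (hd : d ≠ 0)
    (A : Matrix.SpecialLinearGroup (Fin N) K) (b : Fin N → K) : ProjEndo K (Fin (N + 1)) d where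
  form := Fin.snoc
    (fun i : Fin N =>
      ∑ j : Fin N, MvPolynomial.C (A.1 i j) * MvPolynomial.X j.castSucc ^ d +
        MvPolynomial.C (b i) * MvPolynomial.X (Fin.last N) ^ d)
    (MvPolynomial.X (Fin.last N) ^ d)
  isHomogeneous := by
    have hX : ∀ (c : K) (j : Fin (N + 1)), (MvPolynomial.C c *
        (MvPolynomial.X j : MvPolynomial (Fin (N + 1)) K) ^ d).IsHomogeneous d := fun c j => by
      simpa using (MvPolynomial.isHomogeneous_C _ c).mul
        ((MvPolynomial.isHomogeneous_X K j).pow d)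
    intro i
    refine Fin.lastCases ?_ (fun i => ?_) i
    · simpa using (MvPolynomial.isHomogeneous_X K (Fin.last N)).pow d
    · rw [Fin.snoc_castSucc]
      exact (MvPolynomial.IsHomogeneous.sum _ _ _ fun j _ => hX _ _).add (hX _ _)
  eq_zero_of_eval := by
    intro v hv
    have hlast : v (Fin.last N) = 0 := by
      have := hv (Fin.last N)
      simpa [hd] using this
    have hA : A.1.mulVec (fun j => v j.castSucc ^ d) = 0 := by
      funext i
      have := hv i.castSucc
      simpa [hlast, hd, Matrix.mulVec, dotProduct] using this
    have h0 := Matrix.eq_zero_of_mulVec_eq_zero (by rw [A.2]; exact one_ne_zero) hA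
    funext i
    refine Fin.lastCases hlast (fun j => ?_) i
    simpa [hd] using congrFun h0 j

end

/-! Write f(X) = A X^d + b. Since d ≥ 2, every hyperplane x_i = 0 is critical, so PCF puts all the
images f^k({x_i = 0}), k ≥ 1, inside one affine hypersurface F = 0. Each image contains a
hypersurface, hence the zero set of an irreducible factor of F. One point on each factor gives a
finite set Z meeting every image (`ProjEndo.IsPCF.exists_finite_meets`).

Now fix an absolute value and let i be the coordinate where A⁻¹b is largest. If x_i = 0, then
A⁻¹f(x) and A⁻¹b agree in coordinate i, so f(x) is not much smaller than b. If b is large compared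
with A, such a point escapes to infinity at a rate independent of x, which contradicts the
finiteness of Z. Hence |b| ≤ (κ^(N+3) |A|^N)^5, with κ = 1 at finite places
(`AbsoluteValue.SumBound.apply_le_of_meets`). Multiplying over all places bounds h(b) by a constant
plus 5N h(A). -/

/-! ### Images of hypersurfaces under X ↦ A X^d + b -/

namespace MvPolynomial

variable {K σ : Type*} [Field K]

/-- The substitution `X i ↦ c i * X i`. -/
noncomputable def scaleVars (c : σ → K) : MvPolynomial σ K →ₐ[K] MvPolynomial σ K :=
  aeval fun i => C (c i) * X i

theorem scaleVars_monomial (c : σ → K) (m : σ →₀ ℕ) (a : K) :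
    scaleVars c (monomial m a) = monomial m ((m.prod fun i n => c i ^ n) * a) := by
  rw [scaleVars, aeval_monomial, monomial_eq (s := m) (a := _ * a)]
  simp only [mul_pow, map_mul, algebraMap_eq, Finsupp.prod, map_prod, map_pow,
    Finset.prod_mul_distrib]
  ring

theorem coeff_scaleVars (c : σ → K) (p : MvPolynomial σ K) (m : σ →₀ ℕ) :
    coeff m (scaleVars c p) = (m.prod fun i n => c i ^ n) * coeff m p := by
  classical
  induction p using induction_on' with
  | monomial u a =>
    rw [scaleVars_monomial, coeff_monomial, coeff_monomial]
    split_ifs with h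
    · rw [h]
    · simp
  | add p q hp hq => rw [map_add, coeff_add, coeff_add, hp, hq, mul_add]

theorem scaleVars_comp (c e : σ → K) (p : MvPolynomial σ K) :
    scaleVars c (scaleVars e p) = scaleVars (c * e) p := by
  ext m
  simp only [coeff_scaleVars, Pi.mul_apply, mul_pow, Finsupp.prod_mul, mul_assoc]

theorem scaleVars_one (p : MvPolynomial σ K) : scaleVars 1 p = p := by
  ext m
  simp [coeff_scaleVars, Finsupp.prod]

theorem eval_scaleVars (c x : σ → K) (p : MvPolynomial σ K) :
    eval x (scaleVars c p) = eval (c * x) p := by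
  have : ((aeval x : MvPolynomial σ K →ₐ[K] K).comp (scaleVars c)) = aeval (c * x) := by
    ext i
    simp [scaleVars]
  simpa [coe_aeval_eq_eval] using DFunLike.congr_fun this p

/-- A polynomial all of whose exponents are divisible by `d` comes from `expand d`. -/
theorem exists_expand_eq {d : ℕ} {p : MvPolynomial σ K}
    (h : ∀ m, coeff m p ≠ 0 → ∀ i, d ∣ m i) : ∃ q, expand d q = p := by
  classical
  refine ⟨∑ m ∈ p.support, monomial (m.mapRange (· / d) (Nat.zero_div d)) (coeff m p), ?_⟩
  rw [map_sum]
  conv_rhs => rw [as_sum p]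
  refine Finset.sum_congr rfl fun m hm => ?_
  rw [expand_monomial]
  refine congrArg (fun u => monomial u (coeff m p)) (Finsupp.ext fun i => ?_)
  simpa using Nat.mul_div_cancel' (h m (mem_support_iff.1 hm) i)

/-- Pushing a hypersurface forward under the `d`-th power map. -/
theorem exists_pushforward_pow [Finite σ] [IsAlgClosed K] [CharZero K] {d : ℕ} (hd : d ≠ 0)
    {p : MvPolynomial σ K} (hp0 : p ≠ 0) (hpu : ¬ IsUnit p) :
    ∃ q : MvPolynomial σ K, q ≠ 0 ∧ ¬ IsUnit q ∧
      ∀ x : σ → K, eval (x ^ d) q = 0 → ∃ y : σ → K, eval y p = 0 ∧ y ^ d = x ^ d := by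
  classical
  cases nonempty_fintype σ
  have : NeZero d := ⟨hd⟩
  cases nonempty_fintype (rootsOfUnity d K)
  let u : (σ → rootsOfUnity d K) → σ → K := fun ζ i => ((ζ i : Kˣ) : K)
  have hu_mul : ∀ ζ η, u (ζ * η) = u ζ * u η := fun ζ η => by ext i; simp [u]
  have hu_one : u 1 = 1 := by ext i; simp [u]
  -- The norm of p under twisting the variables by d-th roots of unity. Its invariance makes it a
  -- polynomial q in the X_i^d, and a zero of q at x^d is a zero of p at some twist of x.
  set P : MvPolynomial σ K := ∏ ζ : σ → rootsOfUnity d K, scaleVars (u ζ) p with hP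
  have hne : ∀ ζ, scaleVars (u ζ) p ≠ 0 := fun ζ h => hp0 <| by
    have := congrArg (scaleVars (u ζ⁻¹)) h
    rwa [scaleVars_comp, ← hu_mul, inv_mul_cancel, hu_one, scaleVars_one, map_zero] at this
  have hinv : ∀ η, scaleVars (u η) P = P := fun η => by
    rw [hP, map_prod]
    refine Fintype.prod_equiv (Equiv.mulLeft η) _ _ fun ζ => ?_
    rw [scaleVars_comp, Equiv.coe_mulLeft, hu_mul]
  obtain ⟨q, hq⟩ : ∃ q, expand d q = P := by
    refine exists_expand_eq fun m hm i => ?_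
    have : NeZero (d : K) := ⟨Nat.cast_ne_zero.2 hd⟩
    obtain ⟨z, hz⟩ := HasEnoughRootsOfUnity.exists_primitiveRoot K d
    have hzu := hz.toRootsOfUnity
    -- Twisting the i-th variable alone by a primitive root z multiplies the coefficient at m by
    -- z^(m i).
    have h1 := congrArg (coeff m) (hinv (Function.update 1 i hz.toRootsOfUnity))
    rw [coeff_scaleVars, mul_eq_right₀ hm, Finsupp.prod_fintype _ _ (fun _ => pow_zero _),
      Finset.prod_eq_single i] at h1
    · refine hz.dvd_of_pow_eq_one _ ?_
      simpa [u] using h1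
    · intro j _ hj
      simp [u, Function.update_of_ne hj]
    · simp
  refine ⟨q, ?_, ?_, ?_⟩
  · rintro rfl
    rw [map_zero] at hq
    exact Finset.prod_ne_zero_iff.2 (fun ζ _ => hne ζ) hq.symm
  · intro h
    have h2 : IsUnit P := hq ▸ h.map (expand d)
    have h3 := isUnit_of_dvd_unit (Finset.dvd_prod_of_mem (fun ζ => scaleVars (u ζ) p)
      (Finset.mem_univ 1)) h2
    rw [hu_one, scaleVars_one] at h3
    exact hpu h3
  · intro x hx
    have h1 : eval x P = 0 := by
      rwa [← hq, eval_expand]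
    rw [hP, map_prod, Finset.prod_eq_zero_iff] at h1
    obtain ⟨ζ, -, h1⟩ := h1
    rw [eval_scaleVars] at h1
    refine ⟨_, h1, ?_⟩
    ext i
    have : ((ζ i : Kˣ) : K) ^ d = 1 := by
      have := (ζ i).2
      rw [mem_rootsOfUnity] at this
      simpa using congrArg Units.val this
    simp [u, mul_pow, this]

/-- Pushing a hypersurface forward under `X ↦ A X ^ d + b`. -/
theorem exists_pushforward_powerAffine {n : Type*} [Fintype n] [DecidableEq n] [IsAlgClosed K]
    [CharZero K] {d : ℕ} (hd : d ≠ 0) {A : Matrix n n K} (hA : IsUnit A.det) (b : n → K)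
    {p : MvPolynomial n K} (hp0 : p ≠ 0) (hpu : ¬ IsUnit p) :
    ∃ q : MvPolynomial n K, q ≠ 0 ∧ ¬ IsUnit q ∧
      ∀ y : n → K, eval y q = 0 → ∃ x : n → K, eval x p = 0 ∧ A.mulVec (x ^ d) + b = y := by
  obtain ⟨q, hq0, hqu, hq⟩ := exists_pushforward_pow hd hp0 hpu
  let φ : MvPolynomial n K →ₐ[K] MvPolynomial n K :=
    aeval fun i => ∑ j, C (A⁻¹ i j) * (X j - C (b j))
  let ψ : MvPolynomial n K →ₐ[K] MvPolynomial n K :=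
    aeval fun i => ∑ j, C (A i j) * X j + C (b i)
  have hφ : ∀ (y : n → K) r, eval y (φ r) = eval (A⁻¹.mulVec (y - b)) r := fun y r => by
    have : ((aeval y : MvPolynomial n K →ₐ[K] K).comp φ) = aeval (A⁻¹.mulVec (y - b)) := by
      ext i
      simp [φ, Matrix.mulVec, dotProduct]
    simpa [coe_aeval_eq_eval] using DFunLike.congr_fun this r
  have hψ : ∀ (y : n → K) r, eval y (ψ r) = eval (A.mulVec y + b) r := fun y r => by
    have : ((aeval y : MvPolynomial n K →ₐ[K] K).comp ψ) = aeval (A.mulVec y + b) := by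
      ext i
      simp [ψ, Matrix.mulVec, dotProduct]
    simpa [coe_aeval_eq_eval] using DFunLike.congr_fun this r
  have hψφ : ∀ r, ψ (φ r) = r := fun r => by
    have : Infinite K := IsAlgClosed.instInfinite
    refine funext fun y => ?_
    rw [hψ, hφ, add_sub_cancel_right, Matrix.mulVec_mulVec, Matrix.nonsing_inv_mul _ hA,
      Matrix.one_mulVec]
  refine ⟨φ q, fun h => hq0 ?_, fun h => hqu ?_, fun y hy => ?_⟩
  · rw [← hψφ q, h, map_zero]
  · rw [← hψφ q]
    exact h.map ψ
  · rw [hφ] at hy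
    choose x hx using fun i => IsAlgClosed.exists_pow_nat_eq (A⁻¹.mulVec (y - b) i)
      (Nat.pos_of_ne_zero hd)
    have hx' : x ^ d = A⁻¹.mulVec (y - b) := _root_.funext hx
    rw [← hx'] at hy
    obtain ⟨z, hz, hzx⟩ := hq x hy
    refine ⟨z, hz, ?_⟩
    rw [hzx, hx', Matrix.mulVec_mulVec, Matrix.mul_nonsing_inv _ hA, Matrix.one_mulVec,
      sub_add_cancel]

/-- Pushing a hypersurface forward under the iterates of `X ↦ A X ^ d + b`. -/
theorem exists_pushforward_iterate {n : Type*} [Fintype n] [DecidableEq n] [IsAlgClosed K]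
    [CharZero K] {d : ℕ} (hd : d ≠ 0) {A : Matrix n n K} (hA : IsUnit A.det) (b : n → K)
    {p : MvPolynomial n K} (hp0 : p ≠ 0) (hpu : ¬ IsUnit p) (k : ℕ) :
    ∃ q : MvPolynomial n K, q ≠ 0 ∧ ¬ IsUnit q ∧ ∀ y : n → K, eval y q = 0 →
      ∃ x : n → K, eval x p = 0 ∧ (fun v : n → K => A.mulVec (v ^ d) + b)^[k] x = y := by
  induction k with
  | zero => exact ⟨p, hp0, hpu, fun y hy => ⟨y, hy, rfl⟩⟩
  | succ k ih =>
    obtain ⟨q, hq0, hqu, hq⟩ := ih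
    obtain ⟨r, hr0, hru, hr⟩ := exists_pushforward_powerAffine hd hA b hq0 hqu
    refine ⟨r, hr0, hru, fun y hy => ?_⟩
    obtain ⟨z, hz, hzy⟩ := hr y hy
    obtain ⟨x, hx, hxz⟩ := hq z hz
    exact ⟨x, hx, by rw [Function.iterate_succ_apply', hxz, hzy]⟩

/-! ### Hypersurfaces inside a given hypersurface -/

theorem exists_eval_eq_zero [Finite σ] [IsAlgClosed K] {p : MvPolynomial σ K}
    (hp : ¬ IsUnit p) : ∃ x : σ → K, eval x p = 0 := by
  by_contra! h
  have h1 : zeroLocus K (Ideal.span {p}) = ∅ := by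
    rw [zeroLocus_span]
    ext x
    simpa [coe_aeval_eq_eval] using h x
  have h2 := vanishingIdeal_zeroLocus_eq_radical (K := K) (Ideal.span {p})
  rw [h1, vanishingIdeal_empty, eq_comm, Ideal.radical_eq_top, Ideal.span_singleton_eq_top] at h2
  exact hp h2

/-- By the Nullstellensatz F lies in the radical of (p), and p is prime. -/
theorem dvd_of_irreducible_of_zeros_subset [Finite σ] [IsAlgClosed K] {p F : MvPolynomial σ K}
    (hp : Irreducible p) (h : ∀ x, eval x p = 0 → eval x F = 0) : p ∣ F := by
  have h1 : F ∈ vanishingIdeal K (zeroLocus K (Ideal.span {p})) := by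
    rw [zeroLocus_span]
    intro x hx
    simpa [coe_aeval_eq_eval] using h x (by simpa [coe_aeval_eq_eval] using hx)
  rw [vanishingIdeal_zeroLocus_eq_radical] at h1
  obtain ⟨k, hk⟩ := h1
  exact hp.prime.dvd_of_dvd_pow (Ideal.mem_span_singleton.1 hk)

/-- Finitely many points meet all hypersurfaces contained in a given hypersurface. -/
theorem exists_finite_meets_hypersurfaces [Finite σ] [IsAlgClosed K] {F : MvPolynomial σ K}
    (hF : F ≠ 0) : ∃ Z : Set (σ → K), Z.Finite ∧ ∀ q : MvPolynomial σ K, q ≠ 0 → ¬ IsUnit q →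
      (∀ x, eval x q = 0 → eval x F = 0) → ∃ z ∈ Z, eval z q = 0 := by
  classical
  have hz : ∀ p : MvPolynomial σ K, ∃ x : σ → K, ¬ IsUnit p → eval x p = 0 := fun p => by
    by_cases hp : IsUnit p
    · exact ⟨0, fun h => absurd hp h⟩
    · obtain ⟨x, hx⟩ := exists_eval_eq_zero hp
      exact ⟨x, fun _ => hx⟩
  choose z hz using hz
  obtain ⟨s, hs, hsF⟩ := UniqueFactorizationMonoid.exists_prime_factors F hF
  -- One zero of each prime factor of F suffices: an irreducible factor of q divides F, so it is
  -- associated to a member of s.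
  refine ⟨z '' {p | p ∈ s}, (Multiset.finite_toSet s).image z, fun q hq0 hqu hq => ?_⟩
  obtain ⟨p, hp, hpq⟩ := WfDvdMonoid.exists_irreducible_factor hqu hq0
  have hpF : p ∣ F := dvd_of_irreducible_of_zeros_subset hp fun x hx => hq x <| by
    obtain ⟨r, rfl⟩ := hpq
    rw [map_mul, hx, zero_mul]
  obtain ⟨p', hp's, hpp'⟩ := hp.prime.exists_mem_multiset_dvd (hpF.trans hsF.symm.dvd)
  have hass := hp.prime.associated_of_dvd (hs p' hp's) hpp'
  refine ⟨z p', ⟨p', hp's, rfl⟩, ?_⟩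
  obtain ⟨r, hr⟩ := hass.symm.dvd.trans hpq
  rw [hr, map_mul, hz p' (hs p' hp's).not_isUnit, zero_mul]

end MvPolynomial

/-! ### From projective PCF maps to affine orbits -/

namespace MvPolynomial

theorem IsHomogeneous.eval_smul_eq {K σ : Type*} [Field K] {p : MvPolynomial σ K} {m : ℕ}
    (hp : p.IsHomogeneous m) (t : K) (v : σ → K) : eval (t • v) p = t ^ m * eval v p := by
  rw [eval_eq, eval_eq, Finset.mul_sum]
  refine Finset.sum_congr rfl fun u hu => ?_
  have hd : ∑ j ∈ u.support, u j = m := by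
    have := hp (mem_support_iff.mp hu)
    rwa [Finsupp.weight_apply, Finsupp.sum, Finset.sum_congr rfl (g := fun j => u j)
      (fun j _ => by simp)] at this
  simp only [Pi.smul_apply, smul_eq_mul, mul_pow, Finset.prod_mul_distrib,
    Finset.prod_pow_eq_pow_sum, hd]
  ring

/-- Substituting `1` for the last variable. -/
noncomputable def dehomogenize {K : Type*} [Field K] {N : ℕ} :
    MvPolynomial (Fin (N + 1)) K →ₐ[K] MvPolynomial (Fin N) K :=
  aeval (Fin.snoc X 1 : Fin (N + 1) → MvPolynomial (Fin N) K)

theorem eval_dehomogenize {K : Type*} [Field K] {N : ℕ} (p : MvPolynomial (Fin (N + 1)) K)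
    (y : Fin N → K) :
    eval y (dehomogenize p) = eval (Fin.snoc y 1 : Fin (N + 1) → K) p := by
  have : ((aeval y : MvPolynomial (Fin N) K →ₐ[K] K).comp dehomogenize) =
      aeval (Fin.snoc y 1 : Fin (N + 1) → K) := by
    ext i
    refine Fin.lastCases ?_ (fun i => ?_) i <;> simp [dehomogenize]
  simpa [coe_aeval_eq_eval] using DFunLike.congr_fun this p

theorem IsHomogeneous.dehomogenize_ne_zero {K : Type*} [Field K] [Infinite K] {N m : ℕ}
    {p : MvPolynomial (Fin (N + 1)) K} (hp : p.IsHomogeneous m) (hp0 : p ≠ 0) :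
    dehomogenize p ≠ 0 := by
  intro h
  -- The factor X_last disposes of the points at infinity; homogeneity gives the vanishing of p at
  -- all others.
  refine mul_ne_zero hp0 (X_ne_zero (Fin.last N)) (MvPolynomial.funext fun v => ?_)
  rw [map_mul, eval_X, map_zero]
  by_cases hv : v (Fin.last N) = 0
  · rw [hv, mul_zero]
  · have hsnoc : v = v (Fin.last N) •
        (Fin.snoc (fun i => (v (Fin.last N))⁻¹ * v i.castSucc) 1 : Fin (N + 1) → K) := by
      ext i
      refine Fin.lastCases ?_ (fun i => ?_) i
      · simp
      · simp [hv]
    rw [hsnoc, hp.eval_smul_eq, ← eval_dehomogenize, h, map_zero, mul_zero, zero_mul]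

end MvPolynomial

open MvPolynomial

/-- The point of `ℙ^N` with affine coordinates `x`. -/
noncomputable def affinePoint {K : Type*} [Field K] {N : ℕ} (x : Fin N → K) :
    ℙ K (Fin (N + 1) → K) :=
  Projectivization.mk K (Fin.snoc x 1 : Fin (N + 1) → K) fun h => by
    simpa using congrFun h (Fin.last N)

theorem exists_smul_eq_affinePoint_rep {K : Type*} [Field K] {N : ℕ} (x : Fin N → K) :
    ∃ t : K, t ≠ 0 ∧ (affinePoint x).rep = t • (Fin.snoc x 1 : Fin (N + 1) → K) := by
  obtain ⟨t, ht⟩ := Projectivization.exists_smul_eq_mk_rep K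
    (Fin.snoc x 1 : Fin (N + 1) → K) fun h => by simpa using congrFun h (Fin.last N)
  exact ⟨t, t.ne_zero, ht.symm⟩

section PowerAffine

variable {K : Type*} [Field K] {N d : ℕ} (hd : d ≠ 0)
  (A : Matrix.SpecialLinearGroup (Fin N) K) (b : Fin N → K)

theorem powerAffineEndo_toFun_affinePoint (x : Fin N → K) :
    (powerAffineEndo hd A b).toFun (affinePoint x) = affinePoint (A.1.mulVec (x ^ d) + b) := by
  have h : (powerAffineEndo hd A b).evalVec (Fin.snoc x 1) =
      (Fin.snoc (A.1.mulVec (x ^ d) + b) 1 : Fin (N + 1) → K) := by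
    ext i
    refine Fin.lastCases ?_ (fun i => ?_) i
    · simp [ProjEndo.evalVec, powerAffineEndo]
    · simp [ProjEndo.evalVec, powerAffineEndo, Matrix.mulVec, dotProduct]
  simp only [ProjEndo.toFun, affinePoint, Projectivization.lift_mk, h]

theorem powerAffineEndo_iterate_affinePoint (x : Fin N → K) (k : ℕ) :
    (powerAffineEndo hd A b).toFun^[k] (affinePoint x) =
      affinePoint ((fun v : Fin N → K => A.1.mulVec (v ^ d) + b)^[k] x) := by
  induction k with
  | zero => rfl
  | succ k ih =>
    rw [Function.iterate_succ_apply', Function.iterate_succ_apply', ih,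
      powerAffineEndo_toFun_affinePoint]

/-- Column i of the Jacobian matrix is a multiple of x_i^(d-1), and d - 1 > 0. -/
theorem affinePoint_mem_critLocus (hd2 : 2 ≤ d) {x : Fin N → K} {i : Fin N} (hx : x i = 0) :
    affinePoint x ∈ (powerAffineEndo hd A b).critLocus := by
  obtain ⟨t, -, ht⟩ := exists_smul_eq_affinePoint_rep x
  have hrep : (affinePoint x).rep i.castSucc = 0 := by simp [ht, hx]
  have hd1 : d - 1 ≠ 0 := by omega
  rw [ProjEndo.critLocus, Set.mem_ofPred_eq, RingHom.map_det]
  refine Matrix.det_eq_zero_of_column_eq_zero i.castSucc fun j => ?_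
  have hX : ∀ l : Fin (N + 1), eval (affinePoint x).rep
      (pderiv i.castSucc ((X l : MvPolynomial (Fin (N + 1)) K) ^ d)) = 0 := fun l => by
    rw [pderiv_pow, pderiv_X]
    by_cases hl : l = i.castSucc
    · subst hl
      simp [hrep, hd1]
    · simp [hl]
  rw [RingHom.mapMatrix_apply, Matrix.map_apply, Matrix.of_apply]
  refine Fin.lastCases ?_ (fun j => ?_) j
  · simp [powerAffineEndo]
  · simp only [powerAffineEndo, Fin.snoc_castSucc, map_add, map_sum, pderiv_C_mul, map_mul, hX,
      mul_zero, Finset.sum_const_zero, add_zero]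

/-- The affine part of the post-critical locus of a PCF map lies in a hypersurface. -/
theorem ProjEndo.IsPCF.exists_vanishing [Infinite K] (hd2 : 2 ≤ d)
    (h : (powerAffineEndo hd A b).IsPCF) : ∃ F : MvPolynomial (Fin N) K, F ≠ 0 ∧
      ∀ (i : Fin N) (k : ℕ) (x : Fin N → K), x i = 0 →
        eval ((fun v : Fin N → K => A.1.mulVec (v ^ d) + b)^[k + 1] x) F = 0 := by
  obtain ⟨⟨I, hI, hS⟩, hne⟩ := h
  -- Properness of the post-critical locus supplies a defining form that is not identically zero.
  obtain ⟨P, hP⟩ := (Set.ne_univ_iff_exists_notMem _).1 hne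
  rw [hS, Set.mem_ofPred_eq] at hP
  push Not at hP
  obtain ⟨p, hpI, hp⟩ := hP
  obtain ⟨m, hm⟩ := hI p hpI
  refine ⟨dehomogenize p, hm.dehomogenize_ne_zero (by rintro rfl; simp at hp),
    fun i k x hx => ?_⟩
  have hmem : affinePoint ((fun v : Fin N → K => A.1.mulVec (v ^ d) + b)^[k + 1] x) ∈
      (powerAffineEndo hd A b).postCritLocus :=
    Set.mem_iUnion.2 ⟨k, _, affinePoint_mem_critLocus hd A b hd2 hx,
      powerAffineEndo_iterate_affinePoint hd A b x (k + 1)⟩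
  rw [hS] at hmem
  have h0 := hmem p hpI
  obtain ⟨t, ht0, ht⟩ := exists_smul_eq_affinePoint_rep
    ((fun v : Fin N → K => A.1.mulVec (v ^ d) + b)^[k + 1] x)
  rw [ht, hm.eval_smul_eq, ← eval_dehomogenize] at h0
  exact (mul_eq_zero.1 h0).resolve_left (pow_ne_zero _ ht0)

/-- Finitely many points meet all the images `fᵏ({xᵢ = 0})`, `k ≥ 1`, for a PCF map `f`. -/
theorem ProjEndo.IsPCF.exists_finite_meets [IsAlgClosed K] [CharZero K] (hd2 : 2 ≤ d)
    (h : (powerAffineEndo hd A b).IsPCF) : ∃ Z : Set (Fin N → K), Z.Finite ∧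
      ∀ (i : Fin N) (k : ℕ), ∃ x : Fin N → K, x i = 0 ∧
        (fun v : Fin N → K => A.1.mulVec (v ^ d) + b)^[k + 1] x ∈ Z := by
  have : Infinite K := IsAlgClosed.instInfinite
  obtain ⟨F, hF0, hF⟩ := h.exists_vanishing hd A b hd2
  obtain ⟨Z, hZ, hZq⟩ := exists_finite_meets_hypersurfaces hF0
  refine ⟨Z, hZ, fun i k => ?_⟩
  obtain ⟨q, hq0, hqu, hq⟩ := exists_pushforward_iterate hd
    (A := A.1) (by rw [A.2]; exact isUnit_one) b (X_ne_zero i) (X_prime (i := i)).not_isUnit (k + 1)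
  obtain ⟨z, hz, hqz⟩ := hZq q hq0 hqu fun y hy => by
    obtain ⟨x, hx, rfl⟩ := hq y hy
    exact hF i k x (by simpa using hx)
  obtain ⟨x, hx, hxz⟩ := hq z hqz
  exact ⟨x, by simpa using hx, hxz ▸ hz⟩

end PowerAffine

/-! ### The escape estimate at one absolute value -/

/-- Sums of at most `m` terms grow by at most the factor `κ` under the absolute value `w`. -/
def AbsoluteValue.SumBound {L : Type*} [Field L] (w : AbsoluteValue L ℝ) (m : ℕ) (κ : ℝ) : Prop :=
  ∀ (s : Type) [Fintype s], Fintype.card s ≤ m → ∀ (x : s → L) (B : ℝ), 0 ≤ B →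
    (∀ i, w (x i) ≤ B) → w (∑ i, x i) ≤ κ * B

namespace AbsoluteValue

variable {L : Type*} [Field L] (w : AbsoluteValue L ℝ)

/-- Together with `sumBound_one`, this lets a single estimate serve archimedean and nonarchimedean
places. -/
theorem sumBound_natCast {m : ℕ} : w.SumBound m m := fun s _ hs x B hB hx => by
  calc w (∑ i, x i) ≤ ∑ i, w (x i) := w.sum_le _ _
    _ ≤ ∑ _i : s, B := Finset.sum_le_sum fun i _ => hx i
    _ = Fintype.card s * B := by simp
    _ ≤ m * B := by gcongr

theorem sumBound_one {m : ℕ} (hw : IsNonarchimedean w) : w.SumBound m 1 := fun s _ _ x B hB hx => by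
  rw [one_mul]
  cases isEmpty_or_nonempty s
  · simpa using hB
  · exact (hw.apply_sum_le_sup Finset.univ_nonempty).trans (Finset.sup'_le _ _ fun i _ => hx i)

variable {w} {m : ℕ} {κ : ℝ} (hκ : w.SumBound m κ)
include hκ

theorem SumBound.add_le (hm : 2 ≤ m) (x y : L) : w (x + y) ≤ κ * max (w x) (w y) := by
  have := hκ (Fin 2) (by simpa using hm) ![x, y] (max (w x) (w y))
    (le_max_of_le_left (w.nonneg _)) fun i => by fin_cases i <;> simp
  simpa using this

variable {N : ℕ}

theorem SumBound.det_le (hm : N.factorial ≤ m) {A : Matrix (Fin N) (Fin N) L} {a : ℝ}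
    (ha0 : 0 ≤ a) (ha : ∀ i j, w (A i j) ≤ a) : w A.det ≤ κ * a ^ N := by
  rw [Matrix.det_apply]
  refine hκ _ (by simpa [Fintype.card_perm] using hm) _ _ (by positivity) fun σ => ?_
  rw [Units.smul_def, zsmul_eq_mul, map_mul, map_prod]
  have h1 : w ((Equiv.Perm.sign σ : ℤ) : L) = 1 := by
    rcases Int.units_eq_one_or (Equiv.Perm.sign σ) with h | h <;> simp [h]
  rw [h1, one_mul]
  calc ∏ i, w (A (σ i) i) ≤ ∏ _i : Fin N, a :=
        Finset.prod_le_prod (fun i _ => w.nonneg _) fun i _ => ha _ _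
    _ = a ^ N := by simp

/-- An adjugate entry is the determinant of A with one row replaced by a basis vector, whence the
need for 1 ≤ a. -/
theorem SumBound.adjugate_le (hm : N.factorial ≤ m) {A : Matrix (Fin N) (Fin N) L} {a : ℝ}
    (ha1 : 1 ≤ a) (ha : ∀ i j, w (A i j) ≤ a) (i j : Fin N) :
    w (A.adjugate i j) ≤ κ * a ^ N := by
  rw [Matrix.adjugate_apply]
  refine hκ.det_le hm (by linarith) fun k l => ?_
  rw [Matrix.updateRow_apply]
  split_ifs
  · rw [Pi.single_apply]
    split_ifs <;> simp <;> linarith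
  · exact ha _ _

variable [NeZero N]

theorem SumBound.mulVec_le (hm : N ≤ m) {A : Matrix (Fin N) (Fin N) L} {a : ℝ}
    (ha0 : 0 ≤ a) (ha : ∀ i j, w (A i j) ≤ a) (x : Fin N → L) :
    ⨆ i, w (A.mulVec x i) ≤ κ * a * ⨆ i, w (x i) := by
  refine ciSup_le fun i => ?_
  rw [mul_assoc]
  refine hκ (Fin N) (by simpa using hm) _ _ (mul_nonneg ha0 (Real.iSup_nonneg fun i => w.nonneg _))
    fun j => ?_
  rw [map_mul]
  exact mul_le_mul (ha i j) (Finite.le_ciSup (fun i => w (x i)) j) (w.nonneg _) ha0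

/-- If finitely many points meet all the images of the coordinate hyperplanes under the iterates
of `f : X ↦ A X ^ d + b`, then `b` is bounded in terms of `A`. -/
theorem SumBound.apply_le_of_meets (hκ1 : 1 ≤ κ) (hm2 : 2 ≤ m) (hmN : N ≤ m)
    (hmf : N.factorial ≤ m) {d : ℕ} (hd : 2 ≤ d) {A : Matrix (Fin N) (Fin N) L} (hA : A.det = 1)
    (b : Fin N → L) {Z : Set (Fin N → L)} (hZ : Z.Finite)
    (hmeet : ∀ (i : Fin N) (k : ℕ), ∃ x : Fin N → L, x i = 0 ∧
      (fun v : Fin N → L => A.mulVec (v ^ d) + b)^[k + 1] x ∈ Z)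
    {a : ℝ} (ha0 : 0 ≤ a) (ha : ∀ i j, w (A i j) ≤ a) :
    1 ≤ κ ^ (N + 3) * a ^ N ∧ ∀ j, w (b j) ≤ (κ ^ (N + 3) * a ^ N) ^ 5 := by
  have hN : N ≠ 0 := NeZero.ne N
  have hκ0 : 0 < κ := by linarith
  have h1 : 1 ≤ κ * a ^ N := by
    have := hκ.det_le hmf ha0 ha
    rwa [hA, map_one] at this
  have hκa : 1 ≤ κ * a := by
    by_contra! h
    have ha1 : a ≤ 1 := by nlinarith
    have : a ^ N ≤ a := pow_le_of_le_one ha0 ha1 hN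
    nlinarith
  -- M will bound the entries of A and of its inverse, the adjugate. Applying either matrix costs κM
  -- and adding two vectors costs κ, so T = κ²M covers both.
  set T : ℝ := κ ^ (N + 3) * a ^ N with hT
  have hMT : κ ^ 2 * (κ * (κ * a) ^ N) = T := by rw [hT]; ring
  set M : ℝ := κ * (κ * a) ^ N with hM
  have hM1 : 1 ≤ M := one_le_mul_of_one_le_of_one_le hκ1 (one_le_pow₀ hκa)
  have hT1 : 1 ≤ T := hMT ▸ one_le_mul_of_one_le_of_one_le (one_le_pow₀ hκ1) hM1
  have hκMT : κ * M ≤ T := by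
    rw [← hMT]
    gcongr
    nlinarith
  have hAM : ∀ i j, w (A i j) ≤ M := fun i j => by
    have h2 : κ * a ≤ (κ * a) ^ N := le_self_pow₀ hκa hN
    have := ha i j
    nlinarith
  have hadj : ∀ i j, w (A.adjugate i j) ≤ M := hκ.adjugate_le hmf hκa fun i j =>
    (ha i j).trans (by nlinarith)
  refine ⟨hT1, ?_⟩
  set nrm : (Fin N → L) → ℝ := fun x => ⨆ i, w (x i) with hnrm
  have hle : ∀ x i, w (x i) ≤ nrm x := fun x i => Finite.le_ciSup (fun i => w (x i)) i
  have hnrm0 : ∀ x, 0 ≤ nrm x := fun x => Real.iSup_nonneg fun i => w.nonneg _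
  have hAle : ∀ x, nrm (A.mulVec x) ≤ T * nrm x := fun x =>
    (hκ.mulVec_le hmN (by linarith) hAM x).trans (by gcongr; exact hnrm0 x)
  have hadjle : ∀ x, nrm (A.adjugate.mulVec x) ≤ κ * M * nrm x :=
    hκ.mulVec_le hmN (by linarith) hadj
  set f : (Fin N → L) → (Fin N → L) := fun v => A.mulVec (v ^ d) + b with hf
  have hadjA : ∀ x, A.adjugate.mulVec (A.mulVec x) = x := fun x => by
    rw [Matrix.mulVec_mulVec, Matrix.adjugate_mul, hA, one_smul, Matrix.one_mulVec]
  have hAadj : ∀ x, A.mulVec (A.adjugate.mulVec x) = x := fun x => by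
    rw [Matrix.mulVec_mulVec, Matrix.mul_adjugate, hA, one_smul, Matrix.one_mulVec]
  have hpow : ∀ x, nrm x ^ d ≤ T * max (nrm (f x)) (nrm b) := fun x => by
    obtain ⟨i, hi⟩ := exists_eq_ciSup_of_finite (f := fun i => w (x i))
    have h2 : nrm x ^ d ≤ nrm (x ^ d) := by
      rw [hnrm]
      dsimp only
      rw [← hi, ← map_pow]
      exact hle (x ^ d) i
    have h3 : x ^ d = A.adjugate.mulVec (f x + -b) := by
      rw [hf]
      dsimp only
      rw [add_neg_cancel_right, hadjA]
    have h4 : nrm (f x + -b) ≤ κ * max (nrm (f x)) (nrm b) := ciSup_le fun i =>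
      (hκ.add_le hm2 _ _).trans (by
        rw [Pi.neg_apply, w.map_neg]
        gcongr
        · exact hle (f x) i
        · exact hle b i)
    calc nrm x ^ d ≤ nrm (x ^ d) := h2
      _ ≤ κ * M * nrm (f x + -b) := by rw [h3]; exact hadjle _
      _ ≤ κ * M * (κ * max (nrm (f x)) (nrm b)) := by gcongr
      _ = T * max (nrm (f x)) (nrm b) := by rw [← hMT]; ring
  by_contra! hcon
  obtain ⟨j, hj⟩ := hcon
  have hbT : T ^ 5 < nrm b := hj.trans_le (hle b j)
  have hb0 : 0 < nrm b := lt_trans (by positivity) hbT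
  have hT0 : 0 < T := by linarith
  -- The hyperplane to follow: on x_i = 0, the i-th coordinate of A⁻¹f(x) is that of A⁻¹b, here the
  -- largest one.
  obtain ⟨i, hi⟩ := exists_eq_ciSup_of_finite (f := fun i => w (A.adjugate.mulVec b i))
  have hstart : ∀ x, x i = 0 → nrm b ≤ T ^ 2 * nrm (f x) := fun x hx => by
    have h2 : A.adjugate.mulVec b i = A.adjugate.mulVec (f x) i := by
      rw [hf]
      dsimp only
      rw [Matrix.mulVec_add, hadjA]
      simp [hx, show d ≠ 0 by omega]
    calc nrm b = nrm (A.mulVec (A.adjugate.mulVec b)) := by rw [hAadj]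
      _ ≤ T * nrm (A.adjugate.mulVec b) := hAle _
      _ = T * w (A.adjugate.mulVec (f x) i) := by rw [← h2, hi]
      _ ≤ T * (T * nrm (f x)) := by
        gcongr
        exact (hle (A.adjugate.mulVec (f x)) i).trans
          ((hadjle _).trans (by gcongr; exact hnrm0 _))
      _ = T ^ 2 * nrm (f x) := by ring
  -- The expansion factor; the exponent 5 in T^5 < |b| is what gives l > T².
  set l : ℝ := nrm b / T ^ 3 with hl
  have hlb : T ^ 3 * l = nrm b := by rw [hl]; field_simp
  have hl1 : T ^ 2 < l := by
    rw [hl, lt_div_iff₀ (by positivity)]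
    calc T ^ 2 * T ^ 3 = T ^ 5 := by ring
      _ < _ := hbT
  have hl1' : 1 < l := (one_le_pow₀ hT1).trans_lt hl1
  -- Here |x| ≥ Tl and |x|² ≤ |x|^d ≤ T max(|f(x)|, |b|), so l|x| ≤ max(|f(x)|, |b|). The maximum
  -- cannot be |b|, as |b| ≤ T²|x| < l|x|.
  have hstep : ∀ x, nrm b ≤ T ^ 2 * nrm x → l * nrm x ≤ nrm (f x) := fun x hx => by
    have hx1 : T * l ≤ nrm x := by
      rw [← hlb] at hx
      have : T ^ 2 * (T * l) ≤ T ^ 2 * nrm x := by linarith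
      exact le_of_mul_le_mul_left this (by positivity)
    have hx2 : 1 ≤ nrm x := by nlinarith
    have hsq : nrm x ^ 2 ≤ T * max (nrm (f x)) (nrm b) :=
      (pow_le_pow_right₀ hx2 hd).trans (hpow x)
    have h5 : T * (l * nrm x) ≤ T * max (nrm (f x)) (nrm b) := by
      nlinarith
    have h6 := le_of_mul_le_mul_left h5 hT0
    rcases le_max_iff.1 h6 with h | h
    · exact h
    · exfalso
      have h7 : nrm b < l * nrm x := by
        calc nrm b ≤ T ^ 2 * nrm x := hx
          _ < l * nrm x := by gcongr
      linarith
  have hgrow : ∀ (k : ℕ) (x : Fin N → L), x i = 0 → nrm b ≤ T ^ 2 * nrm (f^[k + 1] x) ∧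
      l ^ k * nrm (f x) ≤ nrm (f^[k + 1] x) := fun k x hx => by
    induction k with
    | zero => simpa using hstart x hx
    | succ k ih =>
      have h8 := hstep _ ih.1
      rw [Function.iterate_succ_apply' f (k + 1)]
      refine ⟨ih.1.trans ?_, ?_⟩
      · have := hnrm0 (f^[k + 1] x)
        gcongr
        nlinarith
      · calc l ^ (k + 1) * nrm (f x) = l * (l ^ k * nrm (f x)) := by ring
          _ ≤ l * nrm (f^[k + 1] x) := by
            gcongr
            exact ih.2
          _ ≤ _ := h8
  obtain ⟨R, hR⟩ := (hZ.image nrm).bddAbove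
  -- The growth rate l does not depend on x, so k can be fixed before the point x that `hmeet`
  -- provides.
  obtain ⟨k, hk⟩ := pow_unbounded_of_one_lt R hl1'
  obtain ⟨x, hx, hxZ⟩ := hmeet i k
  have h9 := hR ⟨_, hxZ, rfl⟩
  have h10 := (hgrow k x hx).2
  have h11 : 1 ≤ nrm (f x) := by
    have := hstart x hx
    rw [← hlb] at this
    have h12 : T ^ 2 * (T * l) ≤ T ^ 2 * nrm (f x) := by linarith
    have := le_of_mul_le_mul_left h12 (by positivity)
    nlinarith
  have h13 : l ^ k * 1 ≤ l ^ k * nrm (f x) := by gcongr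
  linarith

end AbsoluteValue

/-! ### Extending places to algebraic extensions -/

/-- An embedding of `K` into a complete nonarchimedean field `E` yields an absolute value on every
algebraic extension of `K`. -/
theorem exists_absoluteValue_extending {K L E : Type*} [Field K] [Field L] [Algebra K L]
    [Algebra.IsAlgebraic K L] [NontriviallyNormedField E] [IsUltrametricDist E] [CompleteSpace E]
    (φ : K →+* E) :
    ∃ w : AbsoluteValue L ℝ, IsNonarchimedean w ∧ ∀ x, w (algebraMap K L x) = ‖φ x‖ := by
  let _ := ((algebraMap E (AlgebraicClosure E)).comp φ).toAlgebra
  -- The absolute value is the spectral norm of E restricted along this embedding.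
  let g : L →ₐ[K] AlgebraicClosure E := IsAlgClosed.lift
  have hadd : ∀ x y : L, spectralNorm E (AlgebraicClosure E) (g (x + y)) ≤
      max (spectralNorm E (AlgebraicClosure E) (g x))
        (spectralNorm E (AlgebraicClosure E) (g y)) := fun x y => by
    rw [map_add]
    exact isNonarchimedean_spectralNorm _ _
  refine ⟨{ toFun := fun x => spectralNorm E (AlgebraicClosure E) (g x)
            map_mul' := fun x y => by
              rw [map_mul]
              exact map_mul (spectralMulAlgNorm E (AlgebraicClosure E)) _ _
            nonneg' := fun x => spectralNorm_nonneg _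
            eq_zero' := fun x => by
              rw [← spectralMulAlgNorm_def, map_eq_zero_iff_eq_zero, map_eq_zero]
            add_le' := fun x y => (hadd x y).trans
              (max_le_add_of_nonneg (spectralNorm_nonneg _) (spectralNorm_nonneg _)) },
    hadd, fun x => ?_⟩
  change spectralNorm E (AlgebraicClosure E) (g (algebraMap K L x)) = _
  rw [g.commutes]
  exact spectralNorm_extends _

namespace NumberField

/-- Needed because Z and the points mapped into it have coordinates in the algebraic closure, not in
the field of definition of f. -/
theorem FinitePlace.exists_absoluteValue_extending {K : Type*} [Field K] [NumberField K]
    (v : FinitePlace K) (L : Type*) [Field L] [Algebra K L] [Algebra.IsAlgebraic K L] :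
    ∃ w : AbsoluteValue L ℝ, IsNonarchimedean w ∧ ∀ x, w (algebraMap K L x) = v x := by
  let P := v.maximalIdeal
  obtain ⟨x, hx0, hx1⟩ : ∃ x : K, x ≠ 0 ∧ ‖embedding (K := K) P x‖ < 1 := by
    obtain ⟨x, hxP, hx0⟩ := Submodule.exists_mem_ne_zero_of_ne_bot P.ne_bot
    exact ⟨algebraMap _ K x, by simpa using hx0, (norm_lt_one_iff_mem K P x).2 hxP⟩
  let _ : NontriviallyNormedField (P.adicCompletion K) :=
    { (inferInstance : NormedField (P.adicCompletion K)) with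
      non_trivial := ⟨embedding (K := K) P x⁻¹, by
        rw [map_inv₀, norm_inv]
        exact (one_lt_inv₀ (norm_pos_iff.2 (by simpa using hx0))).2 hx1⟩ }
  obtain ⟨w, hw, hwx⟩ := _root_.exists_absoluteValue_extending (L := L) (E := P.adicCompletion K)
    (embedding (K := K) P)
  exact ⟨w, hw, fun x => (hwx x).trans (v.norm_embedding_eq x)⟩

theorem InfinitePlace.exists_absoluteValue_extending {K : Type*} [Field K]
    (v : InfinitePlace K) (L : Type*) [Field L] [Algebra K L] [Algebra.IsAlgebraic K L] :
    ∃ w : AbsoluteValue L ℝ, ∀ x, w (algebraMap K L x) = v x := by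
  let _ := v.embedding.toAlgebra
  let g : L →ₐ[K] ℂ := IsAlgClosed.lift
  refine ⟨place g.toRingHom, fun x => ?_⟩
  rw [place_apply, ← v.norm_embedding_eq]
  exact congrArg norm (g.commutes x)

end NumberField

/-! ### Heights under field extension -/

namespace NumberField

open Height Module

theorem prod_infinitePlace_pow_mult (K : Type*) [Field K] [NumberField K]
    (G : (K → ℝ) → ℝ) :
    ∏ v : InfinitePlace K, G v ^ v.mult = ∏ φ : K →+* ℂ, G fun x => ‖φ x‖ := by
  classical
  rw [← Finset.prod_fiberwise Finset.univ InfinitePlace.mk]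
  refine Finset.prod_congr rfl fun v _ => ?_
  rw [← InfinitePlace.card_filter_mk_eq, ← Finset.prod_const]
  refine Finset.prod_congr rfl fun φ hφ => ?_
  rw [← (Finset.mem_filter.1 hφ).2]
  rfl

variable {F K : Type*} [Field F] [NumberField F] [Field K] [NumberField K] [Algebra F K]

/-- Each embedding of F into ℂ extends to K in exactly [K : F] ways. -/
theorem prod_embeddings_comp (G : (F →+* ℂ) → ℝ) :
    ∏ φ : K →+* ℂ, G (φ.comp (algebraMap F K)) = (∏ ψ : F →+* ℂ, G ψ) ^ finrank F K := by
  classical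
  rw [← Finset.prod_fiberwise Finset.univ fun φ : K →+* ℂ => φ.comp (algebraMap F K),
    ← Finset.prod_pow]
  refine Finset.prod_congr rfl fun ψ _ => ?_
  have hcard : (Finset.univ.filter fun φ : K →+* ℂ => φ.comp (algebraMap F K) = ψ).card =
      finrank F K := by
    let _ := ψ.toAlgebra
    rw [← AlgHom.card F K ℂ, ← Finset.card_univ]
    symm
    refine Finset.card_bij (fun φ _ => φ.toRingHom) (fun φ _ => ?_) (fun φ _ φ' _ h => ?_)
      fun φ hφ => ?_
    · exact Finset.mem_filter.2 ⟨Finset.mem_univ _, φ.comp_algebraMap⟩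
    · exact AlgHom.coe_ringHom_injective h
    · exact ⟨{ φ with commutes' := fun x => DFunLike.congr_fun (Finset.mem_filter.1 hφ).2 x },
        Finset.mem_univ _, rfl⟩
  rw [← hcard, ← Finset.prod_const]
  refine Finset.prod_congr rfl fun φ hφ => ?_
  rw [(Finset.mem_filter.1 hφ).2]

theorem absNorm_map_algebraMap (I : Ideal (𝓞 F)) :
    (I.map (algebraMap (𝓞 F) (𝓞 K))).absNorm = I.absNorm ^ finrank F K := by
  rw [← Ideal.absNorm_relNorm (𝓞 F), Ideal.relNorm_algebraMap, map_pow,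
    IsFractionRing.finrank_eq (𝓞 F) F (𝓞 K) K]

variable {ι : Type*} [Finite ι]

/-- For integral coordinates the finite part of the height is the inverse norm of the ideal they
generate, so no splitting of primes is needed; the infinite part is a product over embeddings. -/
theorem mulHeight_algebraMap_comp_integers {x : ι → 𝓞 F} (hx : x ≠ 0) :
    mulHeight (fun i => algebraMap F K (x i)) = mulHeight (fun i => (x i : F)) ^ finrank F K := by
  let y : ι → 𝓞 K := fun i => algebraMap (𝓞 F) (𝓞 K) (x i)
  have hy : y ≠ 0 := fun h => hx <| funext fun i =>
    FaithfulSMul.algebraMap_injective (𝓞 F) (𝓞 K) <|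
      (congrFun h i).trans (map_zero _).symm
  have hyx : ∀ i, (y i : K) = algebraMap F K (x i) := fun i => rfl
  have hx' : (fun i => (x i : F)) ≠ 0 := fun h => hx <| funext fun i =>
    RingOfIntegers.ext (by simpa using congrFun h i)
  have hy' : (fun i => (y i : K)) ≠ 0 := fun h => hy <| funext fun i =>
    RingOfIntegers.ext (by simpa using congrFun h i)
  have hnx := absNorm_mul_finprod_finitePlace_eq_one hx
  have hny := absNorm_mul_finprod_finitePlace_eq_one hy
  have hspan : Ideal.span (Set.range y) =
      (Ideal.span (Set.range x)).map (algebraMap (𝓞 F) (𝓞 K)) := by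
    rw [Ideal.map_span, ← Set.range_comp]
    rfl
  rw [hspan, absNorm_map_algebraMap, Nat.cast_pow] at hny
  have hfin : (∏ᶠ v : FinitePlace K, ⨆ i, v (y i : K)) =
      (∏ᶠ v : FinitePlace F, ⨆ i, v (x i : F)) ^ finrank F K := by
    rw [eq_inv_of_mul_eq_one_right hny, eq_inv_of_mul_eq_one_right hnx, inv_pow]
  simp only [← hyx]
  rw [mulHeight_eq hy', mulHeight_eq hx', hfin, mul_pow,
    prod_infinitePlace_pow_mult F fun f => ⨆ i, f (x i : F),
    prod_infinitePlace_pow_mult K fun f => ⨆ i, f (y i : K), ← prod_embeddings_comp]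
  rfl

theorem mulHeight_algebraMap_comp (x : ι → F) :
    mulHeight (fun i => algebraMap F K (x i)) = mulHeight x ^ finrank F K := by
  by_cases hx : x = 0
  · subst hx
    have : (fun i => algebraMap F K ((0 : ι → F) i)) = 0 := funext fun i => by simp
    rw [this, mulHeight_zero, mulHeight_zero, one_pow]
  cases nonempty_fintype ι
  classical
  -- Clearing denominators leaves the height unchanged and reduces to integral coordinates.
  obtain ⟨c, hc⟩ := IsLocalization.exist_integer_multiples_of_finset (nonZeroDivisors (𝓞 F))
    (Finset.univ.image x)
  have hc0 : ((c : 𝓞 F) : F) ≠ 0 := by simp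
  choose y hy using fun i => hc (x i) (Finset.mem_image_of_mem x (Finset.mem_univ i))
  have hxy : (fun i => (y i : F)) = ((c : 𝓞 F) : F) • x := funext fun i => by
    exact (hy i).trans (Algebra.smul_def _ _)
  have hy0 : y ≠ 0 := by
    rintro rfl
    refine hx ?_
    have : ((c : 𝓞 F) : F) • x = 0 := by
      rw [← hxy]
      funext i
      simp
    exact (smul_eq_zero.1 this).resolve_left hc0
  have h := mulHeight_algebraMap_comp_integers (K := K) hy0
  rw [hxy, mulHeight_smul_eq_mulHeight _ hc0] at h
  rw [← h, ← mulHeight_smul_eq_mulHeight (fun i => algebraMap F K (x i))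
    (c := algebraMap F K ((c : 𝓞 F) : F)) (by simp)]
  congr 1
  funext i
  have := congrFun hxy i
  simp only [Pi.smul_apply, smul_eq_mul] at this ⊢
  rw [this, map_mul]

end NumberField

/-! ### Local bounds to global heights -/

namespace NumberField

open Height Module

variable {K : Type*} [Field K] [NumberField K] {ι ι' : Type*} [Finite ι] [Finite ι']

theorem FinitePlace.hasFiniteMulSupport_iSup {x : ι → K} (hx : x ≠ 0) :
    (fun v : FinitePlace K => ⨆ i, v (x i)).HasFiniteMulSupport := by
  have : Nonempty {j // x j ≠ 0} := nonempty_subtype.2 (Function.ne_iff.1 hx)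
  simp_rw [Finite.iSup_eq_iSup_subtype hx]
  exact .iSup fun i => FinitePlace.hasFiniteMulSupport i.2

/-- Comparing heights place by place. -/
theorem mulHeight_le_of_forall_places {x : ι → K} {y : ι' → K} (hx : x ≠ 0) (hy : y ≠ 0)
    {c : ℝ} (hc : 0 ≤ c) {m : ℕ}
    (hinf : ∀ v : InfinitePlace K, ⨆ i, v (x i) ≤ c * (⨆ i, v (y i)) ^ m)
    (hfin : ∀ v : FinitePlace K, ⨆ i, v (x i) ≤ (⨆ i, v (y i)) ^ m) :
    mulHeight x ≤ c ^ finrank ℚ K * mulHeight y ^ m := by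
  have h0 : ∀ v : InfinitePlace K, 0 ≤ ⨆ i, v (x i) := fun v =>
    Real.iSup_nonneg fun i => apply_nonneg v _
  have h0y : ∀ v : InfinitePlace K, 0 ≤ ⨆ i, v (y i) := fun v =>
    Real.iSup_nonneg fun i => apply_nonneg v _
  have h0' : ∀ v : FinitePlace K, 0 ≤ ⨆ i, v (x i) := fun v =>
    Real.iSup_nonneg fun i => apply_nonneg v _
  have hfy := FinitePlace.hasFiniteMulSupport_iSup hy
  have h1 : (∏ᶠ v : FinitePlace K, ⨆ i, v (x i)) ≤ (∏ᶠ v : FinitePlace K, ⨆ i, v (y i)) ^ m := by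
    rw [finprod_pow hfy]
    exact finprod_le_finprod (FinitePlace.hasFiniteMulSupport_iSup hx) h0' (hfy.fun_pow m) hfin
  have h2 : (∏ v : InfinitePlace K, (⨆ i, v (x i)) ^ v.mult) ≤
      c ^ finrank ℚ K * (∏ v : InfinitePlace K, (⨆ i, v (y i)) ^ v.mult) ^ m := by
    -- The constant c occurs once per infinite place with multiplicity, and the multiplicities sum
    -- to [K : ℚ].
    rw [← InfinitePlace.sum_mult_eq, ← Finset.prod_pow_eq_pow_sum, ← Finset.prod_pow,
      ← Finset.prod_mul_distrib]
    refine Finset.prod_le_prod (fun v _ => pow_nonneg (h0 v) _) fun v _ => ?_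
    rw [pow_right_comm, ← mul_pow]
    exact pow_le_pow_left₀ (h0 v) (hinf v) _
  rw [mulHeight_eq hx, mulHeight_eq hy, mul_pow, ← mul_assoc]
  exact mul_le_mul h2 h1 (finprod_nonneg h0')
    (mul_nonneg (pow_nonneg hc _) (pow_nonneg (Finset.prod_nonneg fun v _ =>
      pow_nonneg (h0y v) _) _))

end NumberField

open Height Module in
/-- The absolute height can be computed in any number field containing the coordinates. -/
theorem absLogHeight_coe {ι : Type*} [Finite ι] (K : IntermediateField ℚ (AlgebraicClosure ℚ))
    [NumberField K] (y : ι → K) :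
    absLogHeight (fun i => (y i : AlgebraicClosure ℚ)) = logHeight y / finrank ℚ K := by
  let x : ι → AlgebraicClosure ℚ := fun i => y i
  have hle : IntermediateField.adjoin ℚ (Set.range x) ≤ K :=
    IntermediateField.adjoin_le_iff.2 (Set.range_subset_iff.2 fun i => (y i).2)
  have hfin : FiniteDimensional ℚ (IntermediateField.adjoin ℚ (Set.range x)) :=
    IntermediateField.finiteDimensional_adjoin fun y _ =>
      ((AlgebraicClosure.isAlgebraic ℚ).isAlgebraic y).isIntegral
  have hnf : NumberField (IntermediateField.adjoin ℚ (Set.range x)) := {}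
  let _ : Algebra (IntermediateField.adjoin ℚ (Set.range x)) K :=
    (IntermediateField.inclusion hle).toRingHom.toAlgebra
  let x' : ι → IntermediateField.adjoin ℚ (Set.range x) :=
    fun i => ⟨x i, IntermediateField.subset_adjoin ℚ _ (Set.mem_range_self i)⟩
  have h1 : (fun i => algebraMap (IntermediateField.adjoin ℚ (Set.range x)) K (x' i)) = y := rfl
  have h2 : absLogHeight x = logHeight x' /
    finrank ℚ (IntermediateField.adjoin ℚ (Set.range x)) := rfl
  have h3 : logHeight y = finrank (IntermediateField.adjoin ℚ (Set.range x)) K * logHeight x' := by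
    rw [logHeight_eq_log_mulHeight, logHeight_eq_log_mulHeight, ← h1,
      NumberField.mulHeight_algebraMap_comp, Real.log_pow]
  have h4 := finrank_mul_finrank ℚ (IntermediateField.adjoin ℚ (Set.range x)) K
  have h5 : (0 : ℝ) < finrank (IntermediateField.adjoin ℚ (Set.range x)) K := by
    have : FiniteDimensional (IntermediateField.adjoin ℚ (Set.range x)) K :=
      FiniteDimensional.right ℚ _ K
    exact_mod_cast finrank_pos
  change absLogHeight x = _
  rw [h2, h3, ← h4, Nat.cast_mul, mul_comm (finrank ℚ _ : ℝ), mul_div_mul_left _ _ h5.ne']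

/-- For the case N = 0, where the tuple is just (1). -/
theorem absLogHeight_eq_zero_of_subsingleton {ι : Type*} [Finite ι] [Subsingleton ι]
    (x : ι → AlgebraicClosure ℚ) : absLogHeight x = 0 := by
  have hfin : FiniteDimensional ℚ (IntermediateField.adjoin ℚ (Set.range x)) :=
    IntermediateField.finiteDimensional_adjoin fun y _ =>
      ((AlgebraicClosure.isAlgebraic ℚ).isAlgebraic y).isIntegral
  have hnf : NumberField (IntermediateField.adjoin ℚ (Set.range x)) := {}
  have h : absLogHeight x = Height.logHeight (fun i => (⟨x i, IntermediateField.subset_adjoin ℚ _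
      (Set.mem_range_self i)⟩ : IntermediateField.adjoin ℚ (Set.range x))) /
    Module.finrank ℚ (IntermediateField.adjoin ℚ (Set.range x)) := rfl
  rw [h, Height.logHeight_eq_zero_of_subsingleton, zero_div]

/-! ### The height bound for PCF maps -/

section Main

open Height Module NumberField

variable {N d : ℕ} {K : IntermediateField ℚ (AlgebraicClosure ℚ)}
  {A : Matrix.SpecialLinearGroup (Fin N) (AlgebraicClosure ℚ)} {b : Fin N → AlgebraicClosure ℚ}
  {A' : Fin N × Fin N → K} {b' : Fin N → K}

/-- The local bound at an absolute value of the algebraic closure, for a PCF map defined over `K`. -/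
theorem ProjEndo.IsPCF.iSup_snoc_le [NeZero N] (hd : 2 ≤ d) (hd0 : d ≠ 0)
    (hA : ∀ i j, A.1 i j = A' (i, j)) (hb : ∀ i, b i = b' i)
    (hpcf : (powerAffineEndo hd0 A b).IsPCF) {w : AbsoluteValue (AlgebraicClosure ℚ) ℝ} {κ : ℝ}
    (hκ1 : 1 ≤ κ) (hκ : w.SumBound (N + 2).factorial κ) {v : K → ℝ} (hwv : ∀ x : K, w x = v x) :
    ⨆ i, v ((Fin.snoc b' 1 : Fin (N + 1) → K) i) ≤
      κ ^ (5 * (N + 3)) * (⨆ p, v (A' p)) ^ (5 * N) := by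
  obtain ⟨Z, hZ, hmeet⟩ := hpcf.exists_finite_meets hd0 A b hd
  -- (N+2)! dominates the numbers of summands in use: 2, N and N!.
  have hNf : N + 2 ≤ (N + 2).factorial := Nat.self_le_factorial _
  have hv0 : ∀ x, 0 ≤ v x := fun x => hwv x ▸ w.nonneg _
  obtain ⟨hT, hbT⟩ := hκ.apply_le_of_meets hκ1 (by omega) (by omega)
    (Nat.factorial_le (by omega)) hd A.2 b hZ hmeet (a := ⨆ p, v (A' p))
    (Real.iSup_nonneg fun p => hv0 _) fun i j => by
      rw [hA, hwv]
      exact Finite.le_ciSup (fun p => v (A' p)) (i, j)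
  have hpow : (κ ^ (N + 3) * (⨆ p, v (A' p)) ^ N) ^ 5 =
      κ ^ (5 * (N + 3)) * (⨆ p, v (A' p)) ^ (5 * N) := by ring
  rw [← hpow]
  refine ciSup_le fun i => ?_
  refine Fin.lastCases ?_ (fun i => ?_) i
  · rw [Fin.snoc_last, ← hwv, IntermediateField.coe_one, map_one]
    exact one_le_pow₀ hT
  · rw [Fin.snoc_castSucc, ← hwv, ← hb]
    exact hbT i

theorem ProjEndo.IsPCF.logHeight_snoc_le [NeZero N] [NumberField K] (hd : 2 ≤ d) (hd0 : d ≠ 0)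
    (hA : ∀ i j, A.1 i j = A' (i, j)) (hb : ∀ i, b i = b' i)
    (hpcf : (powerAffineEndo hd0 A b).IsPCF) :
    logHeight (Fin.snoc b' 1 : Fin (N + 1) → K) ≤
      finrank ℚ K * (5 * (N + 3) * Real.log (N + 2).factorial) + 5 * N * logHeight A' := by
  have : Algebra.IsAlgebraic K (AlgebraicClosure ℚ) := ⟨fun x =>
    (((AlgebraicClosure.isAlgebraic ℚ).isAlgebraic x : IsAlgebraic ℚ x)).tower_top K⟩
  have hκ1 : (1 : ℝ) ≤ (N + 2).factorial := by exact_mod_cast Nat.factorial_pos _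
  have hx : (Fin.snoc b' 1 : Fin (N + 1) → K) ≠ 0 := fun h => by
    simpa using congrFun h (Fin.last N)
  have hy : A' ≠ 0 := fun h => by
    have h1 : A.1 = 0 := by
      ext i j
      rw [hA, h]
      rfl
    have h2 := A.2
    rw [h1, Matrix.det_zero] at h2
    exact zero_ne_one h2
  have hle : mulHeight (Fin.snoc b' 1 : Fin (N + 1) → K) ≤
      (((N + 2).factorial : ℝ) ^ (5 * (N + 3))) ^ finrank ℚ K * mulHeight A' ^ (5 * N) := by
    refine mulHeight_le_of_forall_places hx hy (by positivity) (fun v => ?_) fun v => ?_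
    · obtain ⟨w, hw⟩ := v.exists_absoluteValue_extending (AlgebraicClosure ℚ)
      exact hpcf.iSup_snoc_le hd hd0 hA hb hκ1 w.sumBound_natCast hw
    · obtain ⟨w, hw, hwv⟩ := v.exists_absoluteValue_extending (AlgebraicClosure ℚ)
      simpa using hpcf.iSup_snoc_le hd hd0 hA hb le_rfl (w.sumBound_one hw) hwv
  have hpos := mulHeight_pos A'
  have hlog := Real.log_le_log (mulHeight_pos _) hle
  rw [Real.log_mul (by positivity) (by positivity), Real.log_pow, Real.log_pow, Real.log_pow]
    at hlog
  push_cast at hlog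
  exact hlog

end Main

theorem mainTheorem5 (N d : ℕ) (hd : 2 ≤ d) (B : ℝ) (hB : 0 ≤ B) :
    ∃ C : ℝ, ∀ A : Matrix.SpecialLinearGroup (Fin N) (AlgebraicClosure ℚ),
      matrixHeight A.1 ≤ B → ∀ b : Fin N → AlgebraicClosure ℚ,
        (powerAffineEndo (show d ≠ 0 by omega) A b).IsPCF → affineHeight b ≤ C := by
  -- Dividing the bound over K by [K : ℚ] leaves a constant independent of K; it does not even
  -- involve d.
  refine ⟨5 * (N + 3) * Real.log (N + 2).factorial + 5 * N * B, fun A hAB b hpcf => ?_⟩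
  rcases Nat.eq_zero_or_pos N with rfl | hN
  · have : Subsingleton (Fin (0 + 1)) := inferInstanceAs (Subsingleton (Fin 1))
    have h0 : affineHeight b = 0 := absLogHeight_eq_zero_of_subsingleton _
    rw [h0]
    have : 0 ≤ Real.log ((0 + 2).factorial : ℝ) := Real.log_natCast_nonneg _
    simp only [Nat.cast_zero]
    positivity
  have : NeZero N := ⟨hN.ne'⟩
  let S : Set (AlgebraicClosure ℚ) :=
    Set.range (fun p : Fin N × Fin N => A.1 p.1 p.2) ∪ Set.range b
  have : Finite S := ((Set.finite_range _).union (Set.finite_range _)).to_subtype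
  have hfin : FiniteDimensional ℚ (IntermediateField.adjoin ℚ S) :=
    IntermediateField.finiteDimensional_adjoin fun y _ =>
      ((AlgebraicClosure.isAlgebraic ℚ).isAlgebraic y).isIntegral
  have hnf : NumberField (IntermediateField.adjoin ℚ S) := {}
  let A' : Fin N × Fin N → IntermediateField.adjoin ℚ S := fun p =>
    ⟨A.1 p.1 p.2, IntermediateField.subset_adjoin ℚ _ (.inl (Set.mem_range_self p))⟩
  let b' : Fin N → IntermediateField.adjoin ℚ S := fun i =>
    ⟨b i, IntermediateField.subset_adjoin ℚ _ (.inr (Set.mem_range_self i))⟩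
  have hle := hpcf.logHeight_snoc_le (A' := A') (b' := b') hd (by omega) (fun _ _ => rfl)
    fun _ => rfl
  have hA : matrixHeight A.1 =
      Height.logHeight A' / Module.finrank ℚ (IntermediateField.adjoin ℚ S) :=
    absLogHeight_coe _ A'
  have hb : affineHeight b = Height.logHeight (Fin.snoc b' 1 : Fin (N + 1) → _) /
      Module.finrank ℚ (IntermediateField.adjoin ℚ S) := by
    rw [← absLogHeight_coe, affineHeight]
    congr 1
    ext i
    refine Fin.lastCases ?_ (fun i => ?_) i <;> simp [b']
  have hD : (0 : ℝ) < Module.finrank ℚ (IntermediateField.adjoin ℚ S) := by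
    exact_mod_cast Module.finrank_pos
  rw [hA, div_le_iff₀ hD] at hAB
  rw [hb, div_le_iff₀ hD]
  have : 5 * (N : ℝ) * Height.logHeight A' ≤
      5 * N * (B * Module.finrank ℚ (IntermediateField.adjoin ℚ S)) := by gcongr
  linarith
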